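/- All graphs are finite and simple. For a graph $G$, let $\rho(G)$ be its spectral radius, i.e. the largest eigenvalue of its adjacency matrix. A graph is $F$-free if it has no (not necessarily induced) subgraph isomorphic to $F$. Let $\mathrm{spex}(n,F)$ be the maximum of $\rho(G)$ over all $F$-free graphs $G$ of order $n$, and let $\mathrm{SPEX}(n,F)$ be the family of $F$-free graphs $G$ of order $n$ with $\rho(G)=\mathrm{spex}(n,F)$. **Theorem.** Let $F$ be a tree with bipartition classes $A$ and $B$, where $|A|\le |B|$, and suppose that $q:=|A|-1\ge 1$. Then there is an $N$ depending only on $F$ such that for every $n\ge N$, every graph in $\mathrm{SPEX}(n,F)$ contains the complete bipartite graph $K_{q,n-q}$ as a spanning subgraph. In particular, $\sqrt{q(n-q)}\le \mathrm{spex}(n,F)$ for every $n\ge N$. -/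

import Mathlib

noncomputable section

namespace SimpleGraph

open Classical in
/-- The spectral radius `ρ(G)` of a finite graph: the largest eigenvalue of its (real symmetric)
adjacency matrix. The set of eigenvalues is finite, and nonempty as soon as `G` has a vertex,
so that the supremum is a maximum (`isGreatest_rho`). -/
def rho {V : Type*} [Fintype V] (G : SimpleGraph V) : ℝ :=
  sSup {μ : ℝ | Module.End.HasEigenvalue (Matrix.toLin' (G.adjMatrix ℝ)) μ}

/-- `spex(n, F)`: the maximum spectral radius over all `F`-free graphs of order `n`.
There are finitely many such graphs, and at least one if `F` has an edge
(`isGreatest_spex`). -/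
def spex {W : Type*} (n : ℕ) (F : SimpleGraph W) : ℝ :=
  sSup {r : ℝ | ∃ G : SimpleGraph (Fin n), F.Free G ∧ G.rho = r}

/-- `SPEX(n, F)`: the family of `F`-free graphs of order `n` (on the vertex set `Fin n`) whose
spectral radius equals `spex(n, F)`. -/
def SPEX {W : Type*} (n : ℕ) (F : SimpleGraph W) : Set (SimpleGraph (Fin n)) :=
  {G | F.Free G ∧ G.rho = spex n F}

/-- `G` contains a spanning subgraph isomorphic to `K_{a,b}`. -/
def HasSpanningCompleteBipartite {V : Type*} (G : SimpleGraph V) (a b : ℕ) : Prop :=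
  ∃ H : SimpleGraph V, H ≤ G ∧ Nonempty (H ≃g completeBipartiteGraph (Fin a) (Fin b))

open Classical in
theorem isGreatest_rho {V : Type*} [Fintype V] [Nonempty V] (G : SimpleGraph V) :
    IsGreatest {μ : ℝ | Module.End.HasEigenvalue (Matrix.toLin' (G.adjMatrix ℝ)) μ} G.rho := by
  have hA : (G.adjMatrix ℝ).IsHermitian := by
    rw [Matrix.IsHermitian, Matrix.conjTranspose_eq_transpose_of_trivial]
    exact G.transpose_adjMatrix
  have hfin : {μ : ℝ | Module.End.HasEigenvalue (Matrix.toLin' (G.adjMatrix ℝ)) μ}.Finite :=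
    Module.End.finite_hasEigenvalue _
  obtain ⟨i⟩ := ‹Nonempty V›
  have hne : {μ : ℝ | Module.End.HasEigenvalue (Matrix.toLin' (G.adjMatrix ℝ)) μ}.Nonempty := by
    refine ⟨hA.eigenvalues i, ?_⟩
    have h := hA.eigenvalues_mem_spectrum_real i
    rw [← Matrix.spectrum_toLin'] at h
    exact Module.End.hasEigenvalue_iff_mem_spectrum.2 h
  exact ⟨hne.csSup_mem hfin, fun μ hμ => le_csSup hfin.bddAbove hμ⟩

theorem isGreatest_spex {W : Type*} (n : ℕ) (F : SimpleGraph W) (hF : F ≠ ⊥) :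
    IsGreatest {r : ℝ | ∃ G : SimpleGraph (Fin n), F.Free G ∧ G.rho = r} (spex n F) := by
  have hfin : {r : ℝ | ∃ G : SimpleGraph (Fin n), F.Free G ∧ G.rho = r}.Finite :=
    (Set.finite_range fun G : SimpleGraph (Fin n) => G.rho).subset
      (by rintro r ⟨G, -, rfl⟩; exact ⟨G, rfl⟩)
  have hne : {r : ℝ | ∃ G : SimpleGraph (Fin n), F.Free G ∧ G.rho = r}.Nonempty := by
    refine ⟨_, ⊥, ?_, rfl⟩
    rintro ⟨f⟩
    apply hF
    ext u v
    simpa using fun h : F.Adj u v => f.toHom.map_adj h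
  exact ⟨hne.csSup_mem hfin, fun r hr => le_csSup hfin.bddAbove hr⟩

end SimpleGraph

end

/-!
In an `F`-free graph, greedy embeddings of the tree bound the number of adjacent pairs between
vertex sets `L` and `U` by `q |U| + O(|L|)`. Let `x` be the Perron vector of an extremal graph,
with largest entry `1`. Counting walks of length two gives `ρ² x_w ≤ q deg w + o(n)`, while
`K_{q,n-q}` is `F`-free and so `ρ² ≥ q (n - q)`. Hence vertices with entry near `1` are joined to
almost all others, there are at least `q` of them, and every other entry is small, since
otherwise `q + 1` vertices would have many common neighbors and `F` would embed. If a vertex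
outside the `q` large ones missed one of them, then some such vertex could trade its neighborhood
for these `q` vertices, increasing `ρ` and creating no copy of `F`.
-/

namespace SpexTree

open SimpleGraph Finset Matrix
open scoped Classical

section Embedding

variable {V W : Type*} {G : SimpleGraph V} {F : SimpleGraph W}

lemma exists_copy_extending {l : W} (f : Copy (F.induce {l}ᶜ) G) {u : V} (hu : u ∉ Set.range f)
    (hadj : ∀ a : ({l}ᶜ : Set W), F.Adj a l → G.Adj (f a) u) :
    ∃ g : Copy F G, (∀ a : ({l}ᶜ : Set W), g a = f a) ∧ g l = u := by
  let g (w : W) : V := if h : w ∈ ({l}ᶜ : Set W) then f ⟨w, h⟩ else u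
  have hgf (a : ({l}ᶜ : Set W)) : g a = f a := dif_pos a.2
  have hgl : g l = u := dif_neg (not_not.2 rfl)
  have hhom : ∀ {a b}, F.Adj a b → G.Adj (g a) (g b) := by
    intro a b hab
    by_cases ha : a = l
    · subst ha
      rw [hgl, hgf ⟨b, hab.ne'⟩]
      exact (hadj ⟨b, hab.ne'⟩ hab.symm).symm
    by_cases hb : b = l
    · subst hb
      rw [hgl, hgf ⟨a, ha⟩]
      exact hadj ⟨a, ha⟩ hab
    rw [hgf ⟨a, ha⟩, hgf ⟨b, hb⟩]
    exact f.toHom.map_adj (v := ⟨a, ha⟩) (w := ⟨b, hb⟩) hab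
  have hne (a : ({l}ᶜ : Set W)) : g a ≠ g l := by
    rw [hgf, hgl]
    exact fun h => hu ⟨a, h⟩
  have hinj : Function.Injective g := by
    intro a b hab
    by_cases ha : a = l <;> by_cases hb : b = l
    · rw [ha, hb]
    · exact absurd (ha ▸ hab.symm) (hne ⟨b, hb⟩)
    · exact absurd (hb ▸ hab) (hne ⟨a, ha⟩)
    · rw [hgf ⟨a, ha⟩, hgf ⟨b, hb⟩] at hab
      exact congrArg Subtype.val (f.injective hab)
  exact ⟨⟨⟨g, hhom⟩, hinj⟩, hgf, hgl⟩

lemma exists_mem_notMem_range {ι : Type*} [Fintype ι] (f : ι → V) (P : ι → Finset V)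
    (hf : ∀ i, f i ∈ P i) {S T : Finset V} (hST : S ⊆ T) (hS : #{i | ¬Disjoint (P i) T} < #S) :
    ∃ u ∈ S, u ∉ Set.range f := by
  by_contra! hcover
  refine hS.not_ge <| (card_le_card fun u hu => ?_).trans
    (card_image_le (s := {i | ¬Disjoint (P i) T}) (f := f))
  obtain ⟨i, rfl⟩ := hcover u hu
  exact mem_image_of_mem f <| mem_filter.2
    ⟨mem_univ i, not_disjoint_iff.2 ⟨f i, hf i, hST hu⟩⟩

/- Greedy embedding: remove a leaf, embed the rest, and put the leaf back; its candidates already in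
use are images of vertices with intersecting target sets. -/
theorem exists_copy_mem_of_isTree [Fintype W] (hF : F.IsTree) (P : W → Finset V)
    (hP : ∀ w, (P w).Nonempty)
    (hdeg : ∀ a b, F.Adj a b → ∀ v ∈ P a,
      #{c | ¬Disjoint (P c) (P b)} ≤ #{u ∈ P b | G.Adj v u}) :
    ∃ f : Copy F G, ∀ w, f w ∈ P w := by
  induction hn : Fintype.card W using Nat.strong_induction_on generalizing W with
  | _ n ih =>
  rcases subsingleton_or_nontrivial W with hW | hW
  · choose f hf using hP
    exact ⟨⟨⟨f, fun h => absurd (Subsingleton.elim _ _) h.ne⟩,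
      Function.injective_of_subsingleton f⟩, hf⟩
  obtain ⟨l, hl⟩ := hF.exists_vert_degree_one_of_nontrivial
  obtain ⟨p, hlp, hp⟩ := degree_eq_one_iff_existsUnique_adj.1 hl
  have hrest (T : Finset V) : #{c : ({l}ᶜ : Set W) | ¬Disjoint (P c) T} ≤
      #(({c | ¬Disjoint (P c) T} : Finset W).erase l) :=
    card_le_card_of_injOn Subtype.val (fun c hc => by simpa using ⟨(mem_filter.1 hc).2, c.2⟩)
      Subtype.val_injective.injOn
  obtain ⟨f, hf⟩ := ih _ (hn ▸ Fintype.card_subtype_lt (x := l) (by simp))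
    (F := F.induce ({l}ᶜ : Set W))
    ⟨hF.connected.induce_compl_singleton_of_degree_eq_one hl, hF.isAcyclic.induce _⟩
    (fun w => P w) (fun w => hP w)
    (fun a b hab v hv => (hrest _).trans <| (card_le_card (erase_subset _ _)).trans <|
      hdeg a b hab v hv) rfl
  have hl_mem : l ∈ ({c | ¬Disjoint (P c) (P l)} : Finset W) := by simp [(hP l).ne_empty]
  obtain ⟨u, hu, huf⟩ := exists_mem_notMem_range f (fun w => P w) hf
    (filter_subset (G.Adj (f ⟨p, hlp.ne'⟩)) (P l)) <|
    (hrest _).trans_lt <| (card_erase_lt_of_mem hl_mem).trans_le <|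
      hdeg p l hlp.symm _ (hf ⟨p, hlp.ne'⟩)
  obtain ⟨hul, hpu⟩ := mem_filter.1 hu
  obtain ⟨g, hgf, hgl⟩ := exists_copy_extending f huf fun a ha => by
    obtain rfl : a = ⟨p, hlp.ne'⟩ := Subtype.ext (hp a ha.symm)
    exact hpu
  refine ⟨g, fun w => ?_⟩
  by_cases hw : w = l
  · rwa [hw, hgl]
  · exact hgf ⟨w, hw⟩ ▸ hf ⟨w, hw⟩

theorem exists_card_adj_lt_of_free [Fintype W] (hF : F.IsTree) (hG : F.Free G) {S : Finset V}
    (hS : S.Nonempty) : ∃ v ∈ S, #{u ∈ S | G.Adj v u} < Fintype.card W := by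
  by_contra! h
  obtain ⟨f, -⟩ := exists_copy_mem_of_isTree hF (fun _ => S) (fun _ => hS)
    fun _ _ _ v hv => (card_le_univ _).trans (h v hv)
  exact hG ⟨f⟩

theorem isContained_of_le_card_adj [Fintype W] (hF : F.IsTree) {A : Finset W}
    (hA : F.IsBipartiteWith (A : Set W) (A : Set W)ᶜ) {L U : Finset V} (hLU : Disjoint L U)
    (hL : L.Nonempty) (hU : U.Nonempty)
    (hLdeg : ∀ v ∈ L, Fintype.card W ≤ #{u ∈ U | G.Adj v u})
    (hUdeg : ∀ u ∈ U, #A ≤ #{v ∈ L | G.Adj u v}) : F.IsContained G := by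
  suffices hdeg : ∀ a b, F.Adj a b → ∀ v ∈ if a ∈ A then L else U,
      #{c | ¬Disjoint (if c ∈ A then L else U) (if b ∈ A then L else U)} ≤
        #{u ∈ if b ∈ A then L else U | G.Adj v u} by
    obtain ⟨f, -⟩ := exists_copy_mem_of_isTree hF _ (fun w => by split_ifs <;> assumption) hdeg
    exact ⟨f⟩
  intro a b hab v hv
  rcases hA.mem_of_adj hab with ⟨ha, hb⟩ | ⟨ha, hb⟩
  · have ha : a ∈ A := ha
    have hb : b ∉ A := hb
    simp only [ha, hb, if_true, if_false] at hv ⊢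
    exact (card_le_univ _).trans (hLdeg v hv)
  · have ha : a ∉ A := ha
    have hb : b ∈ A := hb
    simp only [ha, hb, if_true, if_false] at hv ⊢
    refine (card_le_card fun c hc => ?_).trans (hUdeg v hv)
    by_contra hcA
    simp [hcA, hLU.symm] at hc

end Embedding

section EdgeCounting

variable {V : Type*} {G : SimpleGraph V}

lemma card_interedges_eq_sum (L U : Finset V) :
    #(G.interedges L U) = ∑ v ∈ L, #{u ∈ U | G.Adj v u} := by
  simp only [SimpleGraph.interedges, Rel.interedges, card_filter, sum_product]

lemma card_interedges_comm (L U : Finset V) : #(G.interedges L U) = #(G.interedges U L) :=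
  have := G.symm
  Rel.card_interedges_comm L U

lemma card_interedges_insert_left {v : V} {L : Finset V} (hv : v ∉ L) (U : Finset V) :
    #(G.interedges (insert v L) U) = #{u ∈ U | G.Adj v u} + #(G.interedges L U) := by
  rw [card_interedges_eq_sum, card_interedges_eq_sum, sum_insert hv]

lemma card_interedges_insert_right (L : Finset V) {u : V} {U : Finset V} (hu : u ∉ U) :
    #(G.interedges L (insert u U)) = #{v ∈ L | G.Adj u v} + #(G.interedges L U) := by
  rw [card_interedges_comm, card_interedges_insert_left hu, card_interedges_comm]

theorem card_interedges_self_le_of_degenerate {d : ℕ}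
    (hd : ∀ S : Finset V, S.Nonempty → ∃ v ∈ S, #{u ∈ S | G.Adj v u} ≤ d) (S : Finset V) :
    #(G.interedges S S) ≤ 2 * d * #S := by
  induction S using Finset.strongInduction with
  | _ S ih =>
  obtain rfl | hS := S.eq_empty_or_nonempty
  · simp
  obtain ⟨v, hv, hvd⟩ := hd S hS
  obtain ⟨S, hvS, rfl⟩ : ∃ S', v ∉ S' ∧ insert v S' = _ :=
    ⟨_, notMem_erase v S, insert_erase hv⟩
  have hvd' : #{u ∈ S | G.Adj v u} ≤ d :=
    (card_le_card (filter_subset_filter _ (subset_insert v S))).trans hvd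
  rw [card_interedges_insert_left hvS, card_interedges_insert_right S hvS,
    card_insert_of_notMem hvS]
  linarith [ih S (ssubset_insert hvS)]

theorem card_interedges_le_of_peelable {q d : ℕ}
    (hpeel : ∀ L U : Finset V, Disjoint L U → L.Nonempty → U.Nonempty →
      (∃ u ∈ U, #{v ∈ L | G.Adj u v} ≤ q) ∨ ∃ v ∈ L, #{u ∈ U | G.Adj v u} ≤ d)
    (L U : Finset V) (hLU : Disjoint L U) : #(G.interedges L U) ≤ q * #U + d * #L := by
  induction hn : #L + #U using Nat.strong_induction_on generalizing L U with
  | _ n ih =>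
  obtain rfl | hL := L.eq_empty_or_nonempty
  · simp
  obtain rfl | hU := U.eq_empty_or_nonempty
  · simp [card_interedges_eq_sum]
  obtain ⟨u, hu, huq⟩ | ⟨v, hv, hvd⟩ := hpeel L U hLU hL hU
  · obtain ⟨U, huU, rfl⟩ : ∃ U', u ∉ U' ∧ insert u U' = _ := ⟨_, notMem_erase u U, insert_erase hu⟩
    rw [card_insert_of_notMem huU] at hn ⊢
    rw [card_interedges_insert_right L huU]
    linarith [ih _ (by omega) L U (hLU.mono_right (subset_insert u U)) rfl]
  · obtain ⟨L, hvL, rfl⟩ : ∃ L', v ∉ L' ∧ insert v L' = _ := ⟨_, notMem_erase v L, insert_erase hv⟩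
    rw [card_insert_of_notMem hvL] at hn ⊢
    rw [card_interedges_insert_left hvL]
    linarith [ih _ (by omega) L U (hLU.mono_left (subset_insert v L)) rfl]

/-- `G` has at most `q * #U + d * #L` ordered adjacent pairs in `L × U`, so that the vertices of `U`
have on average not much more than `q` neighbors in a set `L` much smaller than `U`. The two sets
may overlap. -/
def SparsePairs (G : SimpleGraph V) (q d : ℕ) : Prop :=
  ∀ L U : Finset V, #(G.interedges L U) ≤ q * #U + d * #L

theorem sparsePairs_of_peelable {q d : ℕ}
    (hd : ∀ S : Finset V, S.Nonempty → ∃ v ∈ S, #{u ∈ S | G.Adj v u} ≤ d)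
    (hpeel : ∀ L U : Finset V, Disjoint L U → L.Nonempty → U.Nonempty →
      (∃ u ∈ U, #{v ∈ L | G.Adj u v} ≤ q) ∨ ∃ v ∈ L, #{u ∈ U | G.Adj v u} ≤ d) :
    SparsePairs G q (3 * d) := by
  intro L U
  have hsplit : G.interedges L U ⊆ G.interedges L (U \ L) ∪ G.interedges L L := by
    intro e he
    simp only [SimpleGraph.interedges, mem_union, Rel.mem_interedges_iff, mem_sdiff] at he ⊢
    tauto
  calc #(G.interedges L U) ≤ #(G.interedges L (U \ L)) + #(G.interedges L L) :=
        (card_le_card hsplit).trans (card_union_le _ _)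
    _ ≤ (q * #(U \ L) + d * #L) + 2 * d * #L :=
        add_le_add (card_interedges_le_of_peelable hpeel _ _ disjoint_sdiff)
          (card_interedges_self_le_of_degenerate hd L)
    _ ≤ (q * #U + d * #L) + 2 * d * #L := by gcongr; exact sdiff_subset
    _ = q * #U + 3 * d * #L := by ring

end EdgeCounting

section CommonNeighbors

variable {V W : Type*} [Fintype V] [Fintype W] {G : SimpleGraph V} {F : SimpleGraph W}

/-- The common neighbors of all the vertices of `T`; Mathlib's `SimpleGraph.commonNeighbors` is
restricted to two vertices. -/
noncomputable def commonNeighborFinset (G : SimpleGraph V) (T : Finset V) : Finset V :=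
  {u | ∀ v ∈ T, G.Adj v u}

lemma mem_commonNeighborFinset {T : Finset V} {u : V} :
    u ∈ commonNeighborFinset G T ↔ ∀ v ∈ T, G.Adj v u := by
  simp [commonNeighborFinset]

theorem card_commonNeighborFinset_lt_of_free (hF : F.IsTree) (hG : F.Free G) {A : Finset W}
    (hA : F.IsBipartiteWith (A : Set W) (A : Set W)ᶜ) {T : Finset V} (hT : T.Nonempty)
    (hAT : #A ≤ #T) : #(commonNeighborFinset G T) < Fintype.card W := by
  by_contra! hcard
  have := hF.connected.nonempty
  have hdisj : Disjoint T (commonNeighborFinset G T) :=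
    disjoint_left.2 fun v hv hv' => (mem_commonNeighborFinset.1 hv' v hv).ne rfl
  refine hG (isContained_of_le_card_adj hF hA hdisj hT
    (card_pos.1 (Fintype.card_pos.trans_le hcard)) (fun v hv => ?_) fun u hu => ?_)
  · rwa [filter_true_of_mem fun u hu => mem_commonNeighborFinset.1 hu v hv]
  · rwa [filter_true_of_mem fun v hv => (mem_commonNeighborFinset.1 hu v hv).symm]

theorem sparsePairs_of_free {V : Type*} {G : SimpleGraph V} (hF : F.IsTree) (hG : F.Free G)
    {A : Finset W} (hA : F.IsBipartiteWith (A : Set W) (A : Set W)ᶜ) {q : ℕ} (hAq : #A ≤ q + 1) :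
    SparsePairs G q (3 * Fintype.card W) := by
  refine sparsePairs_of_peelable (fun S hS => ?_) fun L U hLU hL hU => ?_
  · obtain ⟨v, hv, hlt⟩ := exists_card_adj_lt_of_free hF hG hS
    exact ⟨v, hv, hlt.le⟩
  · by_contra! hdeg
    exact hG (isContained_of_le_card_adj hF hA hLU hL hU (fun v hv => (hdeg.2 v hv).le)
      fun u hu => hAq.trans (hdeg.1 u hu))

end CommonNeighbors

section Spectral

variable {V : Type*} [Fintype V] {G : SimpleGraph V} {x : V → ℝ}

lemma adjMatrix_mulVec_eq_smul_iff {r : ℝ} :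
    G.adjMatrix ℝ *ᵥ x = r • x ↔ ∀ u, ∑ v ∈ G.neighborFinset u, x v = r * x u := by
  simp [funext_iff, adjMatrix_mulVec_apply]

lemma posSemidef_rho_smul_one_sub_adjMatrix [Nonempty V] (G : SimpleGraph V) :
    (G.rho • (1 : Matrix V V ℝ) - G.adjMatrix ℝ).PosSemidef := by
  refine posSemidef_iff_isHermitian_and_spectrum_nonneg.2 ⟨?_, ?_⟩
  · rw [IsHermitian, conjTranspose_eq_transpose_of_trivial, transpose_sub, transpose_smul,
      transpose_one, transpose_adjMatrix]
  · rw [← Algebra.algebraMap_eq_smul_one, ← spectrum.singleton_sub_eq]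
    rintro _ ⟨_, rfl, μ, hμ, rfl⟩
    rw [← spectrum_toLin'] at hμ
    exact sub_nonneg.2 (G.isGreatest_rho.2 (Module.End.hasEigenvalue_iff_mem_spectrum.2 hμ))

lemma dotProduct_rho_smul_one_sub_adjMatrix_mulVec (x : V → ℝ) :
    star x ⬝ᵥ (G.rho • (1 : Matrix V V ℝ) - G.adjMatrix ℝ) *ᵥ x =
      G.rho * (x ⬝ᵥ x) - x ⬝ᵥ G.adjMatrix ℝ *ᵥ x := by
  rw [star_trivial, sub_mulVec, smul_mulVec, one_mulVec, dotProduct_sub, dotProduct_smul,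
    smul_eq_mul]

theorem dotProduct_adjMatrix_mulVec_le [Nonempty V] (x : V → ℝ) :
    x ⬝ᵥ G.adjMatrix ℝ *ᵥ x ≤ G.rho * (x ⬝ᵥ x) := by
  have h := (posSemidef_rho_smul_one_sub_adjMatrix G).dotProduct_mulVec_nonneg x
  rwa [dotProduct_rho_smul_one_sub_adjMatrix_mulVec, sub_nonneg] at h

theorem adjMatrix_mulVec_eq_rho_smul_of_le [Nonempty V]
    (h : G.rho * (x ⬝ᵥ x) ≤ x ⬝ᵥ G.adjMatrix ℝ *ᵥ x) : G.adjMatrix ℝ *ᵥ x = G.rho • x := by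
  have hker := ((posSemidef_rho_smul_one_sub_adjMatrix G).dotProduct_mulVec_zero_iff x).1 <| by
    rw [dotProduct_rho_smul_one_sub_adjMatrix_mulVec, sub_eq_zero]
    exact h.antisymm (dotProduct_adjMatrix_mulVec_le x)
  rwa [sub_mulVec, smul_mulVec, one_mulVec, sub_eq_zero, eq_comm] at hker

theorem le_rho_of_adjMatrix_mulVec_eq {r : ℝ} (hx : x ≠ 0) (h : G.adjMatrix ℝ *ᵥ x = r • x) :
    r ≤ G.rho := by
  obtain ⟨v, -⟩ := Function.ne_iff.1 hx
  have : Nonempty V := ⟨v⟩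
  refine G.isGreatest_rho.2 <| Module.End.hasEigenvalue_of_hasEigenvector (x := x)
    ⟨Module.End.mem_eigenspace_iff.2 ?_, hx⟩
  rwa [toLin'_apply]

/-- A nonnegative eigenvector of the adjacency matrix for the spectral radius, scaled to have
largest entry `1`. For a disconnected graph it may vanish somewhere. -/
structure IsPerronVector (G : SimpleGraph V) (x : V → ℝ) : Prop where
  nonneg : ∀ v, 0 ≤ x v
  le_one : ∀ v, x v ≤ 1
  exists_eq_one : ∃ v, x v = 1
  sum_neighborFinset : ∀ u, ∑ v ∈ G.neighborFinset u, x v = G.rho * x u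

/- Passing from an eigenvector to its entrywise absolute value does not decrease the Rayleigh
quotient. -/
theorem exists_nonneg_adjMatrix_mulVec_eq [Nonempty V] (G : SimpleGraph V) :
    ∃ x : V → ℝ, 0 ≤ x ∧ x ≠ 0 ∧ G.adjMatrix ℝ *ᵥ x = G.rho • x := by
  obtain ⟨y, hy, hy0⟩ := G.isGreatest_rho.1.exists_hasEigenvector
  rw [Module.End.mem_eigenspace_iff, toLin'_apply] at hy
  refine ⟨|y|, abs_nonneg y, by simpa using hy0, adjMatrix_mulVec_eq_rho_smul_of_le ?_⟩
  calc G.rho * (|y| ⬝ᵥ |y|) = y ⬝ᵥ G.adjMatrix ℝ *ᵥ y := by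
        rw [hy, dotProduct_smul, smul_eq_mul]
        simp [dotProduct]
    _ ≤ |y| ⬝ᵥ G.adjMatrix ℝ *ᵥ |y| := by
        simp only [dotProduct_mulVec_adjMatrix]
        gcongr with u _ v _
        split_ifs
        · exact (le_abs_self _).trans_eq (abs_mul _ _)
        · exact le_rfl

theorem exists_isPerronVector [Nonempty V] (G : SimpleGraph V) : ∃ x, IsPerronVector G x := by
  obtain ⟨y, hy, hy0, heig⟩ := exists_nonneg_adjMatrix_mulVec_eq G
  obtain ⟨z, -, hz⟩ := exists_max_image univ y univ_nonempty
  have hz0 : 0 < y z := by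
    obtain ⟨v, hv⟩ := Function.ne_iff.1 hy0
    exact ((hy v).lt_of_ne' hv).trans_le (hz v (mem_univ v))
  refine ⟨fun v => y v / y z, fun v => div_nonneg (hy v) hz0.le,
    fun v => (div_le_one hz0).2 (hz v (mem_univ v)), ⟨z, div_self hz0.ne'⟩, fun u => ?_⟩
  rw [← sum_div, adjMatrix_mulVec_eq_smul_iff.1 heig u, mul_div_assoc]

end Spectral

section Rotation

variable {V : Type*} [Fintype V] {G G' H : SimpleGraph V} {x : V → ℝ} {u : V}

lemma dotProduct_adjMatrix_mulVec_eq_add (hH : G.deleteIncidenceSet u = H) (x : V → ℝ) :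
    x ⬝ᵥ G.adjMatrix ℝ *ᵥ x =
      x ⬝ᵥ H.adjMatrix ℝ *ᵥ x + 2 * (x u * ∑ v ∈ G.neighborFinset u, x v) := by
  let a (i j : V) : ℝ := if G.Adj i j then x i * x j else 0
  let b (i j : V) : ℝ := if H.Adj i j then x i * x j else 0
  have hab (i j : V) :
      a i j = b i j + ((if i = u then a u j else 0) + if j = u then a u i else 0) := by
    by_cases hi : i = u <;> by_cases hj : j = u <;>
      simp [a, b, ← hH, deleteIncidenceSet_adj, hi, hj, G.adj_comm, mul_comm]
  have hsum : ∑ j, a u j = x u * ∑ v ∈ G.neighborFinset u, x v := by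
    rw [mul_sum, neighborFinset_eq_filter, sum_filter]
  rw [dotProduct_mulVec_adjMatrix, dotProduct_mulVec_adjMatrix, ← hsum]
  calc ∑ i, ∑ j, a i j
      = ∑ i, ∑ j, (b i j + ((if i = u then a u j else 0) + if j = u then a u i else 0)) := by
        simp_rw [← hab]
    _ = ∑ i, ∑ j, b i j + 2 * ∑ j, a u j := by
        simp [sum_add_distrib, sum_ite_irrel, two_mul]

theorem rho_lt_rho_of_deleteIncidenceSet_eq
    (hGG' : G.deleteIncidenceSet u = G'.deleteIncidenceSet u) (hx : IsPerronVector G x)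
    (hlt : ∑ v ∈ G.neighborFinset u, x v < ∑ v ∈ G'.neighborFinset u, x v) : G.rho < G'.rho := by
  have : Nonempty V := ⟨u⟩
  by_contra! hle
  have hxx : 0 ≤ x ⬝ᵥ x := sum_nonneg fun v _ => mul_self_nonneg (x v)
  have hform : G'.rho * (x ⬝ᵥ x) ≤ x ⬝ᵥ G'.adjMatrix ℝ *ᵥ x :=
    calc G'.rho * (x ⬝ᵥ x) ≤ G.rho * (x ⬝ᵥ x) := by gcongr
      _ = x ⬝ᵥ G.adjMatrix ℝ *ᵥ x := by
        rw [adjMatrix_mulVec_eq_smul_iff.2 hx.sum_neighborFinset, dotProduct_smul, smul_eq_mul]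
      _ ≤ x ⬝ᵥ G'.adjMatrix ℝ *ᵥ x := by
        have := hx.nonneg u
        rw [dotProduct_adjMatrix_mulVec_eq_add rfl, dotProduct_adjMatrix_mulVec_eq_add hGG'.symm]
        gcongr
  have heig := adjMatrix_mulVec_eq_smul_iff.1 (adjMatrix_mulVec_eq_rho_smul_of_le hform) u
  rw [hx.sum_neighborFinset, heig] at hlt
  exact hlt.not_ge (mul_le_mul_of_nonneg_right hle (hx.nonneg u))

end Rotation

section Reattach

variable {V W : Type*} {G G' : SimpleGraph V} {F : SimpleGraph W} {u : V}

/- A copy of `F` through `u` can be moved off `u` to an unused vertex of `C`. -/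
theorem free_of_neighborSet_subset [Fintype W] (hG : F.Free G)
    (hdel : G.deleteIncidenceSet u = G'.deleteIncidenceSet u) {C : Finset V}
    (hC : Fintype.card W ≤ #C) (hsub : ∀ c ∈ C, G'.neighborSet u ⊆ G.neighborSet c) :
    F.Free G' := by
  have hadj {v w : V} (hv : v ≠ u) (hw : w ≠ u) (h : G'.Adj v w) : G.Adj v w :=
    (deleteIncidenceSet_adj.1 (hdel ▸ deleteIncidenceSet_adj.2 ⟨h, hv, hw⟩)).1
  rintro ⟨f⟩
  by_cases hu : u ∈ Set.range f
  · obtain ⟨l, rfl⟩ := hu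
    have hne (a : ({l}ᶜ : Set W)) : f a ≠ f l := fun h => a.2 (f.injective h)
    let f₀ : Copy (F.induce {l}ᶜ) G :=
      ⟨⟨fun a => f a, fun h => hadj (hne _) (hne _) (f.toHom.map_adj h)⟩,
        f.injective.comp Subtype.val_injective⟩
    have hlt : #((univ.erase l).image f) < #C :=
      (card_image_le.trans_lt (card_erase_lt_of_mem (mem_univ l))).trans_le hC
    obtain ⟨c, hc, hcf⟩ := exists_mem_notMem_of_card_lt_card hlt
    have hc₀ : c ∉ Set.range f₀ := by
      rintro ⟨a, rfl⟩
      exact hcf (mem_image_of_mem f (mem_erase.2 ⟨a.2, mem_univ _⟩))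
    obtain ⟨g, -⟩ := exists_copy_extending f₀ hc₀ fun a ha =>
      (hsub c hc (f.toHom.map_adj ha).symm).symm
    exact hG ⟨g⟩
  · have hne (a : W) : f a ≠ u := fun h => hu ⟨a, h⟩
    exact hG ⟨⟨⟨f, fun h => hadj (hne _) (hne _) (f.toHom.map_adj h)⟩, f.injective⟩⟩

/-- The graph `G` with the neighborhood of `u` replaced by `T`: the switching that increases the
spectral radius when `T` outweighs the neighborhood of `u` in the Perron vector. Meaningful for
`u ∉ T`. -/
def reattach (G : SimpleGraph V) (u : V) (T : Finset V) : SimpleGraph V :=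
  G.deleteIncidenceSet u ⊔ between {u} T ⊤

lemma deleteIncidenceSet_reattach (G : SimpleGraph V) (u : V) (T : Finset V) :
    G.deleteIncidenceSet u = (reattach G u T).deleteIncidenceSet u := by
  ext v w
  simp only [reattach, deleteIncidenceSet_adj, sup_adj, between_adj, Set.mem_singleton_iff]
  tauto

lemma reattach_adj_left {T : Finset V} (hu : u ∉ T) (v : V) :
    (reattach G u T).Adj u v ↔ v ∈ T := by
  have (hv : v ∈ T) : u ≠ v := fun h => hu (h ▸ hv)
  simpa [reattach, deleteIncidenceSet_adj, between_adj, hu] using this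

lemma sum_neighborFinset_lt_sum [Fintype V] {T : Finset V} {x : V → ℝ} (hx : ∀ v, 0 ≤ x v)
    {m : ℕ} {c : ℝ} (hm : #(G.neighborFinset u \ T) ≤ m) (hc : ∀ v ∉ T, x v ≤ c) (hc0 : 0 ≤ c)
    {w : V} (hw : w ∈ T) (hwu : ¬G.Adj u w) (hwx : m * c < x w) :
    ∑ v ∈ G.neighborFinset u, x v < ∑ v ∈ T, x v := by
  have hinter : ∑ v ∈ G.neighborFinset u ∩ T, x v ≤ ∑ v ∈ T.erase w, x v := by
    refine sum_le_sum_of_subset_of_nonneg (fun v hv => ?_) fun v _ _ => hx v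
    have hvu : G.Adj u v := by simpa using (mem_inter.1 hv).1
    exact mem_erase.2 ⟨fun h => hwu (h ▸ hvu), (mem_inter.1 hv).2⟩
  have hsdiff : ∑ v ∈ G.neighborFinset u \ T, x v ≤ m * c :=
    calc ∑ v ∈ G.neighborFinset u \ T, x v ≤ #(G.neighborFinset u \ T) • c :=
          sum_le_card_nsmul _ _ _ fun v hv => hc v (mem_sdiff.1 hv).2
      _ ≤ m * c := by rw [nsmul_eq_mul]; gcongr
  rw [← sum_inter_add_sum_sdiff _ T, ← sum_erase_add T x hw]
  linarith

lemma card_neighborFinset_sdiff_le [Fintype V] [Fintype W] (hF : F.IsTree) (hG : F.Free G)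
    {A : Finset W} (hA : F.IsBipartiteWith (A : Set W) (A : Set W)ᶜ) {T : Finset V}
    (hAT : #A ≤ #T + 1) (hu : u ∉ T) :
    #(G.neighborFinset u \ T) ≤
      #{v ∈ {v ∈ Tᶜ | v ∉ commonNeighborFinset G T} | G.Adj u v} + Fintype.card W := by
  have hcommon : #(commonNeighborFinset G (insert u T)) < Fintype.card W :=
    card_commonNeighborFinset_lt_of_free hF hG hA (insert_nonempty u T)
      (hAT.trans_eq (card_insert_of_notMem hu).symm)
  refine (card_le_card fun v hv => ?_).trans <|
    (card_union_le _ (commonNeighborFinset G (insert u T))).trans (by gcongr)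
  simp only [mem_union, mem_filter, mem_compl, mem_commonNeighborFinset, mem_insert, mem_sdiff,
    mem_neighborFinset, forall_eq_or_imp] at hv ⊢
  tauto

/- Replacing the neighborhood of `u` by `T` raises the spectral radius, and keeps the graph free of
`F`, as a copy of `F` through `u` can use a common neighbor of `T` instead. -/
theorem exists_free_rho_lt_rho [Fintype V] [Fintype W] (hG : F.Free G) {T : Finset V}
    (hT : Fintype.card W ≤ #(commonNeighborFinset G T)) {x : V → ℝ} (hx : IsPerronVector G x)
    (hu : u ∉ T) (hsum : ∑ v ∈ G.neighborFinset u, x v < ∑ v ∈ T, x v) :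
    ∃ G' : SimpleGraph V, F.Free G' ∧ G.rho < G'.rho := by
  have hdel := deleteIncidenceSet_reattach G u T
  have hnbr : (reattach G u T).neighborFinset u = T := by
    ext v
    rw [mem_neighborFinset, reattach_adj_left hu]
  exact ⟨reattach G u T,
    free_of_neighborSet_subset hG hdel hT fun c hc v hv =>
      (mem_commonNeighborFinset.1 hc v ((reattach_adj_left hu v).1 hv)).symm,
    rho_lt_rho_of_deleteIncidenceSet_eq hdel hx (hnbr.symm ▸ hsum)⟩

/- Among the vertices outside `T` that miss a vertex of `T`, some `u` has few neighbors outside `T`,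
since that set is sparse. -/
theorem isCompleteBetween_of_rho_maximal [Fintype V] [Fintype W] (hF : F.IsTree) (hG : F.Free G)
    (hmax : ∀ G' : SimpleGraph V, F.Free G' → G'.rho ≤ G.rho) {A : Finset W}
    (hA : F.IsBipartiteWith (A : Set W) (A : Set W)ᶜ) {T : Finset V} (hAT : #A ≤ #T + 1)
    (hT : Fintype.card W ≤ #(commonNeighborFinset G T)) {x : V → ℝ} (hx : IsPerronVector G x)
    (hlarge : ∀ v ∈ T, 1 / 2 < x v) (hsmall : ∀ v ∉ T, x v ≤ 1 / (4 * Fintype.card W)) :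
    G.IsCompleteBetween T (T : Set V)ᶜ := by
  suffices hS : ({v ∈ Tᶜ | v ∉ commonNeighborFinset G T} : Finset V) = ∅ by
    intro v hv w hw
    by_contra hvw
    have hwS : w ∈ ({v ∈ Tᶜ | v ∉ commonNeighborFinset G T} : Finset V) :=
      mem_filter.2 ⟨mem_compl.2 hw, fun h => hvw (mem_commonNeighborFinset.1 h v hv)⟩
    simp [hS] at hwS
  by_contra hS
  obtain ⟨u, huS, hudeg⟩ := exists_card_adj_lt_of_free hF hG (nonempty_iff_ne_empty.2 hS)
  obtain ⟨huT, huC⟩ := mem_filter.1 huS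
  rw [mem_compl] at huT
  obtain ⟨w, hw, hwu⟩ : ∃ w ∈ T, ¬G.Adj w u := by simpa [mem_commonNeighborFinset] using huC
  have hdeg : #(G.neighborFinset u \ T) ≤ 2 * Fintype.card W := by
    linarith [card_neighborFinset_sdiff_le hF hG hA hAT huT]
  have hwx : ((2 * Fintype.card W : ℕ) : ℝ) * (1 / (4 * Fintype.card W)) < x w := by
    have := hF.connected.nonempty
    convert hlarge w hw using 1
    push_cast
    field_simp
    norm_num
  obtain ⟨G', hG', hlt⟩ := exists_free_rho_lt_rho hG hT hx huT <|
    sum_neighborFinset_lt_sum hx.nonneg hdeg hsmall (by positivity) hw (fun h => hwu h.symm) hwx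
  exact (hmax G' hG').not_gt hlt

end Reattach

section PerronVector

variable {V : Type*} [Fintype V] {G : SimpleGraph V} {q d : ℕ} {x : V → ℝ}

lemma sum_sum_neighborFinset_eq (U : Finset V) (y : V → ℝ) :
    ∑ u ∈ U, ∑ v ∈ G.neighborFinset u, y v = ∑ v, #{u ∈ U | G.Adj v u} * y v := by
  simp_rw [neighborFinset_eq_filter, sum_filter]
  rw [sum_comm]
  refine sum_congr rfl fun v _ => ?_
  simp_rw [G.adj_comm _ v]
  rw [← sum_filter, sum_const, nsmul_eq_mul]

/- Vertices with at most `d` neighbors in `U` are paid for by `d * ∑ v, y v`; at the others the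
excess over `d` is at most `q * #U` in total. -/
theorem SparsePairs.sum_sum_neighborFinset_le (hG : SparsePairs G q d) {y : V → ℝ} {c : ℝ}
    (hy : ∀ v, 0 ≤ y v) (hyc : ∀ v, y v ≤ c) (hc : 0 ≤ c) (U : Finset V) :
    ∑ u ∈ U, ∑ v ∈ G.neighborFinset u, y v ≤ c * (q * #U) + d * ∑ v, y v := by
  let k (v : V) : ℕ := #{u ∈ U | G.Adj v u}
  let L : Finset V := {v | d ≤ k v}
  have hpoint (v : V) : k v * y v ≤ (if v ∈ L then c * (k v - d) else 0) + d * y v := by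
    split_ifs with hv
    · have hd : (d : ℝ) ≤ k v := by exact_mod_cast (mem_filter.1 hv).2
      linarith [mul_le_mul_of_nonneg_left (hyc v) (sub_nonneg.2 hd)]
    · have hd : (k v : ℝ) ≤ d := by
        exact_mod_cast (not_le.1 fun h => hv (mem_filter.2 ⟨mem_univ v, h⟩)).le
      linarith [mul_le_mul_of_nonneg_right hd (hy v)]
  have hexcess : ∑ v ∈ L, ((k v : ℝ) - d) ≤ q * #U := by
    have h := hG L U
    rw [card_interedges_eq_sum] at h
    have h : (∑ v ∈ L, k v : ℝ) ≤ q * #U + d * #L := by exact_mod_cast h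
    rw [sum_sub_distrib, sum_const, nsmul_eq_mul]
    linarith
  calc ∑ u ∈ U, ∑ v ∈ G.neighborFinset u, y v = ∑ v, k v * y v := sum_sum_neighborFinset_eq U y
    _ ≤ ∑ v, ((if v ∈ L then c * (k v - d) else 0) + d * y v) :=
        sum_le_sum fun v _ => hpoint v
    _ = c * ∑ v ∈ L, ((k v : ℝ) - d) + d * ∑ v, y v := by
        rw [sum_add_distrib, sum_ite_mem, univ_inter, ← mul_sum, ← mul_sum]
    _ ≤ c * (q * #U) + d * ∑ v, y v := by gcongr

lemma IsPerronVector.sum_sum_neighborFinset (hx : IsPerronVector G x) (U : Finset V) :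
    ∑ u ∈ U, ∑ v ∈ G.neighborFinset u, x v = G.rho * ∑ u ∈ U, x u := by
  simp_rw [hx.sum_neighborFinset, mul_sum]

lemma IsPerronVector.sum_sum_neighborFinset_neighborFinset (hx : IsPerronVector G x) (w : V) :
    ∑ u ∈ G.neighborFinset w, ∑ v ∈ G.neighborFinset u, x v = G.rho ^ 2 * x w := by
  rw [hx.sum_sum_neighborFinset, hx.sum_neighborFinset, ← mul_assoc, sq]

theorem SparsePairs.rho_mul_sum_le (hG : SparsePairs G q d) (hx : IsPerronVector G x) :
    G.rho * ∑ v, x v ≤ q * Fintype.card V + d * ∑ v, x v := by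
  have h := hG.sum_sum_neighborFinset_le hx.nonneg hx.le_one zero_le_one univ
  rwa [hx.sum_sum_neighborFinset, one_mul, card_univ] at h

theorem SparsePairs.rho_sq_mul_le (hG : SparsePairs G q d) (hx : IsPerronVector G x) (w : V) :
    G.rho ^ 2 * x w ≤ q * G.degree w + d * ∑ v, x v := by
  have h := hG.sum_sum_neighborFinset_le hx.nonneg hx.le_one zero_le_one (G.neighborFinset w)
  rwa [hx.sum_sum_neighborFinset_neighborFinset, one_mul, card_neighborFinset_eq_degree] at h

/- Truncating the Perron vector at `1 - ε` changes it by at most `ε`, and only at the vertices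
counted on the right. -/
theorem SparsePairs.rho_sq_le (hG : SparsePairs G q d) (hx : IsPerronVector G x) {ε : ℝ}
    (hε0 : 0 ≤ ε) (hε1 : ε ≤ 1) :
    G.rho ^ 2 ≤ (1 - ε) * (q * Fintype.card V) + d * ∑ v, x v +
      ε * (#{v | 1 - ε < x v} * Fintype.card V) := by
  obtain ⟨w, hw⟩ := hx.exists_eq_one
  let M : Finset V := {v | 1 - ε < x v}
  let y (v : V) : ℝ := min (x v) (1 - ε)
  have hxy (v : V) : x v ≤ y v + if v ∈ M then ε else 0 := by
    split_ifs with hv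
    · rw [← min_add_add_right, sub_add_cancel]
      exact le_min (le_add_of_nonneg_right hε0) (hx.le_one v)
    · have hv : x v ≤ 1 - ε := by simpa [M] using hv
      simp [y, hv]
  have htrunc := hG.sum_sum_neighborFinset_le (y := y)
    (fun v => le_min (hx.nonneg v) (sub_nonneg.2 hε1)) (fun v => min_le_right _ _)
    (sub_nonneg.2 hε1) (G.neighborFinset w)
  have hdeg : (#(G.neighborFinset w) : ℝ) ≤ Fintype.card V := by exact_mod_cast card_le_univ _
  calc G.rho ^ 2 = ∑ u ∈ G.neighborFinset w, ∑ v ∈ G.neighborFinset u, x v := by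
        rw [hx.sum_sum_neighborFinset_neighborFinset, hw, mul_one]
    _ ≤ ∑ u ∈ G.neighborFinset w, ∑ v ∈ G.neighborFinset u, (y v + if v ∈ M then ε else 0) := by
        gcongr; exact hxy _
    _ = ∑ u ∈ G.neighborFinset w, ∑ v ∈ G.neighborFinset u, y v +
          ∑ u ∈ G.neighborFinset w, #(G.neighborFinset u ∩ M) * ε := by
        simp_rw [sum_add_distrib, sum_ite_mem, sum_const, nsmul_eq_mul]
    _ ≤ ((1 - ε) * (q * #(G.neighborFinset w)) + d * ∑ v, y v) +
          ∑ _ ∈ G.neighborFinset w, #M * ε := by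
        gcongr
        exact inter_subset_right
    _ = (1 - ε) * (q * #(G.neighborFinset w)) + d * ∑ v, y v +
          ε * (#M * #(G.neighborFinset w)) := by
        rw [sum_const, nsmul_eq_mul]; ring
    _ ≤ (1 - ε) * (q * Fintype.card V) + d * ∑ v, x v + ε * (#M * Fintype.card V) := by
        have hy (v : V) : y v ≤ x v := min_le_left _ _
        have := sub_nonneg.2 hε1
        gcongr
        exact hy _

lemma card_compl_commonNeighborFinset_le (G : SimpleGraph V) (T : Finset V) :
    #(commonNeighborFinset G T)ᶜ ≤ ∑ v ∈ T, #(G.neighborFinset v)ᶜ := by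
  refine (card_le_card fun u hu => ?_).trans card_biUnion_le
  simpa [mem_commonNeighborFinset] using hu

variable {κ : ℝ}

theorem card_compl_neighborFinset_le (hG : SparsePairs G q d) (hx : IsPerronVector G x)
    (hq : 1 ≤ q) (hρ : q * Fintype.card V ≤ G.rho ^ 2 + κ * Fintype.card V)
    (hsum : d * ∑ v, x v ≤ κ * Fintype.card V) (w : V) :
    (#(G.neighborFinset w)ᶜ : ℝ) ≤ (1 - x w + 2 * κ) * Fintype.card V := by
  have hq : (1 : ℝ) ≤ q := by exact_mod_cast hq
  have hκ : 0 ≤ κ * Fintype.card V :=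
    (mul_nonneg d.cast_nonneg (sum_nonneg fun v _ => hx.nonneg v)).trans hsum
  have hdeg : (q * Fintype.card V - κ * Fintype.card V) * x w ≤
      q * G.degree w + κ * Fintype.card V :=
    calc (q * Fintype.card V - κ * Fintype.card V) * x w ≤ G.rho ^ 2 * x w :=
          mul_le_mul_of_nonneg_right (by linarith) (hx.nonneg w)
      _ ≤ q * G.degree w + d * ∑ v, x v := hG.rho_sq_mul_le hx w
      _ ≤ q * G.degree w + κ * Fintype.card V := by gcongr
  have hcompl : (#(G.neighborFinset w)ᶜ : ℝ) = Fintype.card V - G.degree w := by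
    rw [card_compl, Nat.cast_sub (card_le_univ _), card_neighborFinset_eq_degree]
  rw [hcompl]
  refine le_of_mul_le_mul_left ?_ (zero_lt_one.trans_le hq)
  nlinarith [mul_le_mul_of_nonneg_left (hx.le_one w) hκ, mul_le_mul_of_nonneg_right hq hκ]

theorem le_card_filter_lt (hG : SparsePairs G q d) (hx : IsPerronVector G x)
    (hκ0 : 0 < κ) (hκ1 : 3 * κ ≤ 1) (hρ : q * Fintype.card V ≤ G.rho ^ 2 + κ * Fintype.card V)
    (hsum : d * ∑ v, x v ≤ κ * Fintype.card V) : q ≤ #{v | 1 - 3 * κ < x v} := by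
  by_contra! hlt
  have hlt : (#{v | 1 - 3 * κ < x v} : ℝ) + 1 ≤ q := by exact_mod_cast hlt
  obtain ⟨w, -⟩ := hx.exists_eq_one
  have hn : (0 : ℝ) < Fintype.card V := by exact_mod_cast Fintype.card_pos_iff.2 ⟨w⟩
  have hκn := mul_pos hκ0 hn
  have h := hG.rho_sq_le hx (by positivity) hκ1
  have := mul_le_mul_of_nonneg_left hlt hκn.le
  linarith

theorem exists_dominating_set {s : ℝ} {t : ℕ} (hG : SparsePairs G q d) (hx : IsPerronVector G x)
    (hq : 1 ≤ q) (hκ0 : 0 < κ) (hκs : (5 * q + 2) * κ ≤ s / 2) (hs : s ≤ 1 / 2)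
    (hρ : q * Fintype.card V ≤ G.rho ^ 2 + κ * Fintype.card V)
    (hsum : d * ∑ v, x v ≤ κ * Fintype.card V) (ht : t < s / 2 * Fintype.card V)
    (hcommon : ∀ T : Finset V, q < #T → #(commonNeighborFinset G T) < t) :
    ∃ T : Finset V, #T = q ∧ t ≤ #(commonNeighborFinset G T) ∧
      (∀ v ∈ T, 1 / 2 < x v) ∧ ∀ v ∉ T, x v ≤ s := by
  have hqκ : κ ≤ q * κ := le_mul_of_one_le_left hκ0.le (by exact_mod_cast hq)
  obtain ⟨T, hTM, hT⟩ :=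
    exists_subset_card_eq (le_card_filter_lt hG hx hκ0 (by linarith) hρ hsum)
  have hTx (v : V) (hv : v ∈ T) : 1 - 3 * κ < x v := (mem_filter.1 (hTM hv)).2
  have hmiss := card_compl_neighborFinset_le hG hx hq hρ hsum
  have hcard (S : Finset V) : (Fintype.card V : ℝ) ≤
      #(commonNeighborFinset G S) + ∑ v ∈ S, (#(G.neighborFinset v)ᶜ : ℝ) := by
    have h := card_compl_commonNeighborFinset_le G S
    rw [card_compl, Nat.sub_le_iff_le_add'] at h
    exact_mod_cast h
  have hTsum : ∑ v ∈ T, (#(G.neighborFinset v)ᶜ : ℝ) ≤ 5 * q * κ * Fintype.card V :=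
    calc ∑ v ∈ T, (#(G.neighborFinset v)ᶜ : ℝ) ≤ ∑ v ∈ T, 5 * κ * Fintype.card V :=
          sum_le_sum fun v hv => (hmiss v).trans <| by gcongr; linarith [hTx v hv]
      _ = 5 * q * κ * Fintype.card V := by rw [sum_const, hT, nsmul_eq_mul]; ring
  have hn := mul_le_mul_of_nonneg_right hκs (Fintype.card V).cast_nonneg
  have hsn := mul_le_mul_of_nonneg_right hs (Fintype.card V).cast_nonneg
  have hκn := mul_nonneg hκ0.le (Fintype.card V).cast_nonneg
  refine ⟨T, hT, ?_, fun v hv => by linarith [hTx v hv], fun v hv => ?_⟩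
  · have : (t : ℝ) ≤ #(commonNeighborFinset G T) := by linarith [hcard T]
    exact_mod_cast this
  · by_contra! hvs
    have hlt : (#(commonNeighborFinset G (insert v T)) : ℝ) < t := by
      exact_mod_cast hcommon (insert v T) (by simp [card_insert_of_notMem hv, hT])
    have hins := hcard (insert v T)
    rw [sum_insert hv] at hins
    have := mul_le_mul_of_nonneg_right hvs.le (Fintype.card V).cast_nonneg
    linarith [hmiss v]

end PerronVector

theorem eventually_exists_dominating_set {q : ℕ} (hq : 1 ≤ q) (d t : ℕ) {s : ℝ} (hs0 : 0 < s)
    (hs : s ≤ 1 / 2) :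
    ∀ᶠ n : ℕ in Filter.atTop, ∀ (G : SimpleGraph (Fin n)) (x : Fin n → ℝ), SparsePairs G q d →
      IsPerronVector G x → √((q : ℝ) * ((n : ℝ) - q)) ≤ G.rho →
      (∀ T : Finset (Fin n), q < #T → #(commonNeighborFinset G T) < t) →
      ∃ T : Finset (Fin n), #T = q ∧ t ≤ #(commonNeighborFinset G T) ∧
        (∀ v ∈ T, 1 / 2 < x v) ∧ ∀ v ∉ T, x v ≤ s := by
  have hq0 : (0 : ℝ) < q := by exact_mod_cast hq
  let κ : ℝ := s / 2 / (5 * q + 2)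
  have hκ : 0 < κ := by positivity
  have hκs : (5 * q + 2) * κ = s / 2 := mul_div_cancel₀ _ (by positivity)
  have hcast : Filter.Tendsto (fun n : ℕ => (n : ℝ)) Filter.atTop Filter.atTop :=
    tendsto_natCast_atTop_atTop
  have hsqrt : Filter.Tendsto (fun n : ℕ => √((q : ℝ) * ((n : ℝ) - q))) Filter.atTop
      Filter.atTop :=
    Real.tendsto_sqrt_atTop.comp <|
      (Filter.tendsto_atTop_add_const_right _ (-(q : ℝ)) hcast).const_mul_atTop hq0
  filter_upwards [hsqrt.eventually_ge_atTop (d * q / κ + d),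
    (hcast.const_mul_atTop hκ).eventually_ge_atTop ((q : ℝ) ^ 2),
    (hcast.const_mul_atTop (half_pos hs0)).eventually_gt_atTop (t : ℝ)]
    with n hnρ hnq hnt G x hG hx hρ hcommon
  refine exists_dominating_set hG hx hq hκ hκs.le hs ?_ ?_ (by rwa [Fintype.card_fin]) hcommon
  · rw [Fintype.card_fin]
    linarith [(Real.sqrt_le_iff.1 hρ).2]
  · have hd : d * q ≤ κ * (G.rho - d) := by
      rw [← div_le_iff₀' hκ]
      linarith
    have hx0 : 0 ≤ ∑ v, x v := sum_nonneg fun v _ => hx.nonneg v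
    have hsum := hG.rho_mul_sum_le hx
    refine le_of_mul_le_mul_left ?_ hq0
    calc q * (d * ∑ v, x v) = d * q * ∑ v, x v := by ring
      _ ≤ κ * (G.rho - d) * ∑ v, x v := by gcongr
      _ = κ * (G.rho * ∑ v, x v - d * ∑ v, x v) := by ring
      _ ≤ κ * (q * Fintype.card (Fin n)) := by gcongr; linarith
      _ = q * (κ * Fintype.card (Fin n)) := by ring

section JoinCompl

variable {V W : Type*} {F : SimpleGraph W}

/-- The complete bipartite graph between `T` and its complement, a copy of `K_{q,n-q}` on a given
vertex set when `#T = q`. -/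
def joinCompl (T : Finset V) : SimpleGraph V :=
  between T (T : Set V)ᶜ ⊤

lemma joinCompl_adj {T : Finset V} {u v : V} : (joinCompl T).Adj u v ↔ (u ∈ T ↔ v ∉ T) := by
  have : u = v → (u ∈ T ↔ v ∈ T) := fun h => h ▸ Iff.rfl
  simp only [joinCompl, between_adj, top_adj, mem_coe, Set.mem_compl_iff]
  tauto

lemma nonempty_joinCompl_iso [Fintype V] (T : Finset V) :
    Nonempty (joinCompl T ≃g completeBipartiteGraph (Fin #T) (Fin (Fintype.card V - #T))) := by
  have eT : {v // v ∈ T} ≃ Fin #T := T.equivFin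
  have eTc : {v // v ∉ T} ≃ Fin (Fintype.card V - #T) :=
    Fintype.equivFinOfCardEq (by simp [Fintype.card_subtype_compl])
  refine ⟨⟨(Equiv.sumCompl (· ∈ T)).symm.trans (Equiv.sumCongr eT eTc), fun {u v} => ?_⟩⟩
  by_cases hu : u ∈ T <;> by_cases hv : v ∈ T <;>
    simp [joinCompl_adj, hu, hv, Equiv.sumCompl_symm_apply_of_pos,
      Equiv.sumCompl_symm_apply_of_neg]

lemma hasSpanningCompleteBipartite_of_isCompleteBetween [Fintype V] {G : SimpleGraph V}
    {T : Finset V} (h : G.IsCompleteBetween T (T : Set V)ᶜ) :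
    G.HasSpanningCompleteBipartite #T (Fintype.card V - #T) := by
  refine ⟨joinCompl T, fun u v huv => ?_, nonempty_joinCompl_iso T⟩
  rw [joinCompl_adj] at huv
  by_cases hu : u ∈ T
  · exact h hu (huv.1 hu)
  · exact (h (not_not.1 (mt huv.2 hu)) hu).symm

theorem sqrt_le_rho_joinCompl [Fintype V] {T : Finset V} (hT : T.Nonempty)
    (hTV : #T < Fintype.card V) :
    √((#T : ℝ) * ((Fintype.card V : ℝ) - #T)) ≤ (joinCompl T).rho := by
  let x (v : V) : ℝ := if v ∈ T then √(#Tᶜ : ℝ) else √(#T : ℝ)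
  have hx : x ≠ 0 := by
    obtain ⟨w, -, hw⟩ := exists_mem_notMem_of_card_lt_card (t := univ) hTV
    exact Function.ne_iff.2 ⟨w, by simp [x, hw, hT.ne_empty]⟩
  rw [← Nat.cast_sub hTV.le, ← card_compl, Real.sqrt_mul (Nat.cast_nonneg _)]
  refine le_rho_of_adjMatrix_mulVec_eq hx (adjMatrix_mulVec_eq_smul_iff.2 fun u => ?_)
  by_cases hu : u ∈ T
  · have hnbr : (joinCompl T).neighborFinset u = Tᶜ := by ext; simp [joinCompl_adj, hu]
    rw [hnbr, sum_congr rfl fun v hv => if_neg (mem_compl.1 hv), sum_const, nsmul_eq_mul]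
    simp only [x, hu, if_true]
    rw [mul_assoc, Real.mul_self_sqrt (Nat.cast_nonneg _), mul_comm]
  · have hnbr : (joinCompl T).neighborFinset u = T := by ext; simp [joinCompl_adj, hu]
    rw [hnbr, sum_congr rfl fun v hv => if_pos hv, sum_const, nsmul_eq_mul]
    simp only [x, hu, if_false]
    rw [mul_right_comm, Real.mul_self_sqrt (Nat.cast_nonneg _)]

theorem eq_or_eq_compl_of_connected (hF : F.Connected) {A B : Set W}
    (hA : ∀ ⦃a b⦄, F.Adj a b → (a ∈ A ↔ b ∉ A))
    (hB : ∀ ⦃a b⦄, F.Adj a b → (a ∈ B ↔ b ∉ B)) :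
    A = B ∨ A = Bᶜ := by
  obtain ⟨r⟩ := hF.nonempty
  have hagree (w : W) : (r ∈ A ↔ r ∈ B) ↔ (w ∈ A ↔ w ∈ B) := by
    obtain ⟨p⟩ := hF.preconnected r w
    induction p with
    | nil => rfl
    | cons h _ ih =>
      have := hA h
      have := hB h
      tauto
  by_cases hr : r ∈ A ↔ r ∈ B
  · exact .inl <| Set.ext fun w => (hagree w).1 hr
  · exact .inr <| Set.ext fun w => by have := mt (hagree w).2 hr; rw [Set.mem_compl_iff]; tauto

theorem free_joinCompl (hF : F.Connected) {A B : Finset W}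
    (hAB : F.IsBipartiteWith (A : Set W) (B : Set W)) {T : Finset V} (hTA : #T < #A)
    (hTB : #T < #B) : F.Free (joinCompl T) := by
  rintro ⟨f⟩
  have hle {S : Finset W} (hS : ∀ w ∈ S, f w ∈ T) : #S ≤ #T :=
    card_le_card_of_injOn f hS f.injective.injOn
  have hBA (b : W) (hb : b ∈ (B : Set W)) : b ∉ (A : Set W) := Set.disjoint_right.1 hAB.disjoint hb
  have hcross ⦃a b : W⦄ (hab : F.Adj a b) : a ∈ (A : Set W) ↔ b ∉ (A : Set W) := by
    rcases hAB.mem_of_adj hab with ⟨ha, hb⟩ | ⟨ha, hb⟩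
    · exact iff_of_true ha (hBA b hb)
    · exact iff_of_false (hBA a ha) (not_not.2 hb)
  obtain h | h := eq_or_eq_compl_of_connected hF hcross (B := f ⁻¹' T)
    fun a b hab => joinCompl_adj.1 (f.toHom.map_adj hab)
  · exact hTA.not_ge <| hle fun w hw => (Set.ext_iff.1 h w).1 hw
  · exact hTB.not_ge <| hle fun w hw =>
      not_not.1 fun hwT => hBA w hw ((Set.ext_iff.1 h w).2 hwT)

end JoinCompl

section Spex

variable {W : Type*} {F : SimpleGraph W} {n : ℕ}

lemma rho_le_spex (hF : F ≠ ⊥) {G : SimpleGraph (Fin n)} (hG : F.Free G) : G.rho ≤ spex n F :=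
  (isGreatest_spex n F hF).2 ⟨G, hG, rfl⟩

theorem ne_bot_of_connected (hF : F.Connected) {A B : Finset W}
    (hAB : F.IsBipartiteWith (A : Set W) (B : Set W)) (hA : A.Nonempty) (hB : B.Nonempty) :
    F ≠ ⊥ := by
  rintro rfl
  obtain ⟨a, ha⟩ := hA
  obtain ⟨b, hb⟩ := hB
  have := (connected_bot_iff.1 hF).1
  exact Set.disjoint_left.1 hAB.disjoint ha (Subsingleton.elim a b ▸ hb)

theorem sqrt_le_spex (hF : F.Connected) {A B : Finset W}
    (hAB : F.IsBipartiteWith (A : Set W) (B : Set W)) {q : ℕ} (hq : 1 ≤ q) (hqA : q < #A)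
    (hqB : q < #B) (hn : q < n) : √((q : ℝ) * ((n : ℝ) - q)) ≤ spex n F := by
  have hF₀ : F ≠ ⊥ := ne_bot_of_connected hF hAB (card_pos.1 (Nat.zero_lt_of_lt hqA))
    (card_pos.1 (Nat.zero_lt_of_lt hqB))
  obtain ⟨T, -, rfl⟩ := exists_subset_card_eq (s := (univ : Finset (Fin n))) (n := q)
    (by simpa using hn.le)
  have h := sqrt_le_rho_joinCompl (card_pos.1 hq) (by simpa using hn)
  rw [Fintype.card_fin] at h
  exact h.trans (rho_le_spex hF₀ (free_joinCompl hF hAB hqA hqB))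

theorem eventually_isCompleteBetween_of_rho_maximal [Finite W] (hF : F.IsTree) {A : Finset W}
    (hA : F.IsBipartiteWith (A : Set W) (A : Set W)ᶜ) {q : ℕ} (hAq : #A ≤ q + 1) (hq : 1 ≤ q) :
    ∀ᶠ n : ℕ in Filter.atTop, ∀ G : SimpleGraph (Fin n), F.Free G →
      (∀ G' : SimpleGraph (Fin n), F.Free G' → G'.rho ≤ G.rho) →
      √((q : ℝ) * ((n : ℝ) - q)) ≤ G.rho →
      ∃ T : Finset (Fin n), #T = q ∧ G.IsCompleteBetween T (T : Set (Fin n))ᶜ := by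
  have := Fintype.ofFinite W
  have := hF.connected.nonempty
  have hW : (1 : ℝ) ≤ Fintype.card W := by exact_mod_cast Fintype.card_pos
  have hs : 1 / (4 * (Fintype.card W : ℝ)) ≤ 1 / 2 := by gcongr; linarith
  filter_upwards [eventually_exists_dominating_set hq (3 * Fintype.card W) (Fintype.card W)
    (by positivity) hs, Filter.eventually_gt_atTop 0] with n hn hn0 G hG hmax hρ
  have : NeZero n := ⟨hn0.ne'⟩
  obtain ⟨x, hx⟩ := exists_isPerronVector G
  obtain ⟨T, rfl, hT, hlarge, hsmall⟩ := hn G x (sparsePairs_of_free hF hG hA hAq) hx hρ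
    fun T hqT => card_commonNeighborFinset_lt_of_free hF hG hA
      (card_pos.1 (Nat.zero_lt_of_lt hqT)) (hAq.trans hqT)
  exact ⟨T, rfl, isCompleteBetween_of_rho_maximal hF hG hmax hA hAq hT hx hlarge hsmall⟩

end Spex

end SpexTree

theorem theorem1p1 {W : Type*} [Fintype W] [DecidableEq W] (F : SimpleGraph W) (hF : F.IsTree)
    (A B : Finset W) (hAB : F.IsBipartiteWith (A : Set W) (B : Set W))
    (hcover : A ∪ B = Finset.univ) (hcard : A.card ≤ B.card)
    (q : ℕ) (hqA : A.card = q + 1) (hq : 1 ≤ q) :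
    ∀ᶠ n : ℕ in Filter.atTop,
      (∀ G ∈ SimpleGraph.SPEX n F, G.HasSpanningCompleteBipartite q (n - q)) ∧
        Real.sqrt ((q : ℝ) * ((n : ℝ) - (q : ℝ))) ≤ SimpleGraph.spex n F := by
  have hB : (A : Set W)ᶜ = B :=
    compl_eq_iff_isCompl.2
      ⟨hAB.disjoint, codisjoint_iff.2 (by simp [← Finset.coe_union, hcover])⟩
  have hF₀ : F ≠ ⊥ := SpexTree.ne_bot_of_connected hF.connected hAB
    (Finset.card_pos.1 (by omega)) (Finset.card_pos.1 (by omega))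
  filter_upwards [Filter.eventually_gt_atTop q,
    SpexTree.eventually_isCompleteBetween_of_rho_maximal hF (hB ▸ hAB) hqA.le hq] with n hqn hn
  have hsqrt : √((q : ℝ) * ((n : ℝ) - q)) ≤ SimpleGraph.spex n F :=
    SpexTree.sqrt_le_spex hF.connected hAB hq (by omega) (by omega) hqn
  refine ⟨fun G ⟨hG, hGρ⟩ => ?_, hsqrt⟩
  obtain ⟨T, rfl, hT⟩ := hn G hG (fun G' hG' => hGρ ▸ SpexTree.rho_le_spex hF₀ hG') (hGρ ▸ hsqrt)
  simpa using SpexTree.hasSpanningCompleteBipartite_of_isCompleteBetween hT
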